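/- Let $\mathcal H$ be a complex Hilbert space (of finite or infinite dimension), and let $A$ be a bounded linear operator on $\mathcal H$. Write $w(A)=\sup_{\|x\|=1}|\langle x,Ax\rangle|$ for the numerical radius of $A$ (with $w(A)=0$ if $\mathcal H=\{0\}$), $\|\cdot\|$ for the operator norm, and call an operator $T$ on a complex Hilbert space positive if $\langle x,Tx\rangle\ge 0$ for all $x$. The following conditions are equivalent: (i) $w(A)\le 1$. (ii) There exist bounded operators $X$ and $Y$ on $\mathcal H$ such that $X^*X+Y^*Y=I$ and $A=2X^*Y$. (iii) There exists a bounded operator $C$ on $\mathcal H$ such that $\|C\|\le 1$ and $A=2(I-C^*C)^{1/2}C$, where $(\cdot)^{1/2}$ is the positive square root. (iv) There exists a bounded Hermitian (self-adjoint) operator $H$ on $\mathcal H$ such that the $2\times 2$ block operator $$\begin{bmatrix} I+H & A^*\\ A & I-H\end{bmatrix}$$ on $\mathcal H\oplus\mathcal H$ is positive. -/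

import Mathlib

open scoped InnerProductSpace

noncomputable section

/-- The numerical radius `w(A) = sup {|⟨x, A x⟩| : ‖x‖ = 1}` of a bounded operator. The set is
bounded above by `‖A‖`, so the real supremum is the true one (on the zero space the set is empty
and the value is `0`). -/
def numericalRadius {H : Type*} [NormedAddCommGroup H] [InnerProductSpace ℂ H]
    (A : H →L[ℂ] H) : ℝ :=
  sSup {r : ℝ | ∃ x : H, ‖x‖ = 1 ∧ r = ‖⟪x, A x⟫_ℂ‖}

/-- The operator on the Hilbert space direct sum `H ⊕ H` with block matrix `[[P, Q], [R, S]]`,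
that is, `(x, y) ↦ (P x + Q y, R x + S y)`. -/
def blockOperator {H : Type*} [NormedAddCommGroup H] [InnerProductSpace ℂ H]
    (P Q R S : H →L[ℂ] H) : WithLp 2 (H × H) →L[ℂ] WithLp 2 (H × H) :=
  (WithLp.prodContinuousLinearEquiv 2 ℂ H H).symm.toContinuousLinearMap ∘L
    ((P.coprod Q).prod (R.coprod S)) ∘L
      (WithLp.prodContinuousLinearEquiv 2 ℂ H H).toContinuousLinearMap

end

/-! The hard implication is (i) → (iii), an operator Fejér–Riesz factorization. If `w(A) ≤ 1`, then
`1 + Re (e^{iθ} A) ≥ 0` for every `θ`, so the tridiagonal Toeplitz kernel with off-diagonal entry `D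
= A / 2` is positive semidefinite (`tridiagonalKernel_posSemidef`). Its reproducing kernel space
carries an isometric shift `S` with `S Eₙ = Eₙ₊₁` (`exists_shift`). Splitting `E₀ = B + S G` with `G
= S* E₀` gives `B* B + G* G = 1` and `A = 2 B* G`; the polar decomposition of `B` then turns `G`
into `C` and `B` into `(1 - C* C)^{1/2}`. The implications (iii) → (ii) → (iv) → (i) are direct
computations. -/

/-- Two linear maps with equal norms, the first of dense range: the second factors isometrically
through the first. -/
lemma exists_linearIsometry_of_norm_eq {V E F : Type*} [AddCommGroup V] [Module ℂ V]
    [NormedAddCommGroup E] [InnerProductSpace ℂ E]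
    [NormedAddCommGroup F] [InnerProductSpace ℂ F] [CompleteSpace F]
    (e : V →ₗ[ℂ] E) (f : V →ₗ[ℂ] F) (he : DenseRange e) (h : ∀ x, ‖f x‖ = ‖e x‖) :
    ∃ L : E →ₗᵢ[ℂ] F, ∀ x, L (e x) = f x := by
  have hL : ∀ x, f.extendOfNorm e (e x) = f x :=
    LinearMap.extendOfNorm_eq he ⟨1, fun x ↦ by simp [h x]⟩
  refine ⟨⟨(f.extendOfNorm e).toLinearMap, fun x ↦ ?_⟩, hL⟩
  refine he.induction_on x (isClosed_eq ?_ continuous_norm) fun y ↦ ?_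
  · exact (f.extendOfNorm e).continuous.norm
  · simp [hL, h]

open ContinuousLinearMap in
/-- A column contraction `A = 2 B* G`, `B* B + G* G = 1` into an auxiliary Hilbert space can be
brought to the form `A = 2 (1 - C* C)^{1/2} C` if the range of `B` is dense enough. -/
lemma exists_eq_two_smul_sqrt_mul {H 𝓗 : Type*}
    [NormedAddCommGroup H] [InnerProductSpace ℂ H] [CompleteSpace H]
    [NormedAddCommGroup 𝓗] [InnerProductSpace ℂ 𝓗] [CompleteSpace 𝓗]
    (A : H →L[ℂ] H) (B G : H →L[ℂ] 𝓗)
    (hBG : ∀ x y, ⟪B x, B y⟫_ℂ + ⟪G x, G y⟫_ℂ = ⟪x, y⟫_ℂ)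
    (hA : ∀ x y, ⟪x, A y⟫_ℂ = 2 * ⟪B x, G y⟫_ℂ)
    (hG : ∀ x, G x ∈ (LinearMap.range (B : H →ₗ[ℂ] 𝓗)).topologicalClosure) :
    ∃ C : H →L[ℂ] H, ‖C‖ ≤ 1 ∧ A = (2 : ℂ) • (CFC.sqrt (1 - star C * C) * C) := by
  set M := (LinearMap.range (B : H →ₗ[ℂ] 𝓗)).topologicalClosure with hM
  have hcM : IsClosed (M : Set 𝓗) := Submodule.isClosed_topologicalClosure _
  have : CompleteSpace M := hcM.completeSpace_coe
  have hBM : ∀ x, (B : H →ₗ[ℂ] 𝓗) x ∈ M := fun x ↦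
    Submodule.le_topologicalClosure _ (LinearMap.mem_range_self _ x)
  set e : H →ₗ[ℂ] M := (B : H →ₗ[ℂ] 𝓗).codRestrict M hBM with he
  have hdense : DenseRange e := by
    intro y
    rw [Metric.mem_closure_iff]
    intro ε hε
    obtain ⟨_, ⟨x, rfl⟩, hx⟩ := Metric.mem_closure_iff.1 (show (y : 𝓗) ∈ closure _ from y.2) ε hε
    exact ⟨e x, ⟨x, rfl⟩, hx⟩
  set P : H →L[ℂ] H := adjoint B ∘L B with hP
  have hP0 : 0 ≤ P := by
    rw [nonneg_iff_isPositive]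
    exact isPositive_adjoint_comp_self B
  set Q : H →L[ℂ] H := CFC.sqrt P with hQ
  have hQQ : Q * Q = P := CFC.sqrt_mul_sqrt_self P hP0
  have hQs : IsSelfAdjoint Q := IsSelfAdjoint.of_nonneg (CFC.sqrt_nonneg P)
  have hQi : ∀ x y, ⟪Q x, y⟫_ℂ = ⟪x, Q y⟫_ℂ := fun x y ↦ hQs.isSymmetric x y
  have hQB : ∀ x y, ⟪Q x, Q y⟫_ℂ = ⟪B x, B y⟫_ℂ := fun x y ↦ by
    rw [hQi, ← adjoint_inner_right B]
    exact congrArg (fun T : H →L[ℂ] H ↦ ⟪x, T y⟫_ℂ) hQQ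
  have hnorm : ∀ x, ‖(Q : H →ₗ[ℂ] H) x‖ = ‖e x‖ := fun x ↦ by
    have h1 : ‖Q x‖ = ‖B x‖ := by
      rw [@norm_eq_sqrt_re_inner ℂ, hQB, ← @norm_eq_sqrt_re_inner ℂ]
    exact h1
  -- `L` inverts the polar isometry of `B`: it sends `B x` to `Q x`, where `Q = (B* B)^{1/2}`.
  obtain ⟨L, hL⟩ := exists_linearIsometry_of_norm_eq e (Q : H →ₗ[ℂ] H) hdense hnorm
  let C : H →L[ℂ] H := L.toContinuousLinearMap ∘L G.codRestrict M hG
  have hC : ∀ x, C x = L ⟨G x, hG x⟩ := fun x ↦ rfl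
  have hCC : ∀ x y, ⟪C x, C y⟫_ℂ = ⟪G x, G y⟫_ℂ := fun x y ↦ by
    rw [hC, hC, L.inner_map_map]
    rfl
  have hsub : 1 - star C * C = P := by
    rw [sub_eq_iff_eq_add, eq_comm]
    refine ContinuousLinearMap.ext fun y ↦ ext_inner_left ℂ fun x ↦ ?_
    have h1 : ⟪x, (star C * C) y⟫_ℂ = ⟪C x, C y⟫_ℂ := adjoint_inner_right C x (C y)
    have h2 : ⟪x, P y⟫_ℂ = ⟪B x, B y⟫_ℂ := adjoint_inner_right B x (B y)
    rw [add_apply, inner_add_right, h1, h2, hCC, hBG]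
    rfl
  refine ⟨C, ?_, ?_⟩
  · refine C.opNorm_le_bound zero_le_one fun x ↦ ?_
    have h1 := congrArg RCLike.re (hBG x x)
    have h2 := congrArg RCLike.re (hCC x x)
    simp only [map_add, inner_self_eq_norm_sq] at h1 h2
    rw [one_mul]
    refine abs_le_of_sq_le_sq' ?_ (norm_nonneg x) |>.2
    nlinarith [sq_nonneg ‖B x‖]
  · rw [hsub]
    refine ContinuousLinearMap.ext fun y ↦ ext_inner_left ℂ fun x ↦ ?_
    have h1 : ⟪x, Q (C y)⟫_ℂ = ⟪B x, G y⟫_ℂ := by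
      rw [← hQi, hC]
      have : Q x = L (e x) := (hL x).symm
      rw [this, L.inner_map_map]
      rfl
    rw [hA, smul_apply, inner_smul_right]
    exact congrArg (2 * ·) h1.symm

open ContinuousLinearMap in
/-- Wold-type decomposition of a stationary sequence with tridiagonal Gram kernel. -/
lemma exists_eq_two_smul_sqrt_mul_of_shift {H 𝓗 : Type*}
    [NormedAddCommGroup H] [InnerProductSpace ℂ H] [CompleteSpace H]
    [NormedAddCommGroup 𝓗] [InnerProductSpace ℂ 𝓗] [CompleteSpace 𝓗]
    (A : H →L[ℂ] H) (E : ℕ → H →L[ℂ] 𝓗) (S : 𝓗 →ₗᵢ[ℂ] 𝓗)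
    (hS : ∀ n v, S (E n v) = E (n + 1) v)
    (hE : ∀ y, (∀ n v, ⟪E n v, y⟫_ℂ = 0) → y = 0)
    (h0 : ∀ v w, ⟪E 0 v, E 0 w⟫_ℂ = ⟪v, w⟫_ℂ)
    (h1 : ∀ v w, 2 * ⟪E 1 v, E 0 w⟫_ℂ = ⟪v, A w⟫_ℂ)
    (h2 : ∀ n v w, ⟪E (n + 2) v, E 0 w⟫_ℂ = 0) :
    ∃ C : H →L[ℂ] H, ‖C‖ ≤ 1 ∧ A = (2 : ℂ) • (CFC.sqrt (1 - star C * C) * C) := by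
  set T : 𝓗 →L[ℂ] 𝓗 := S.toContinuousLinearMap with hT
  have hTr : ∀ x y, ⟪x, adjoint T y⟫_ℂ = ⟪S x, y⟫_ℂ := fun x y ↦ adjoint_inner_right T x y
  have hTl : ∀ x y, ⟪adjoint T x, y⟫_ℂ = ⟪x, S y⟫_ℂ := fun x y ↦ adjoint_inner_left T y x
  set G : H →L[ℂ] 𝓗 := adjoint T ∘L E 0 with hG
  have hGa : ∀ v, G v = adjoint T (E 0 v) := fun v ↦ rfl
  -- Tridiagonality enters here: `E (n + 2) ⊥ E 0` says `S*² E 0 = 0`.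
  have hTG : ∀ v, adjoint T (G v) = 0 := fun v ↦ hE _ fun n w ↦ by
    rw [hTr, hGa, hTr, hS, hS, h2]
  set B : H →L[ℂ] 𝓗 := E 0 - T ∘L G with hB
  have hBa : ∀ v, B v = E 0 v - S (G v) := fun v ↦ rfl
  have hE0SG : ∀ x y, ⟪E 0 x, S y⟫_ℂ = ⟪G x, y⟫_ℂ := fun x y ↦ by rw [hGa, hTl]
  have hSGE0 : ∀ x y, ⟪S x, E 0 y⟫_ℂ = ⟪x, G y⟫_ℂ := fun x y ↦ by rw [hGa, hTr]
  have hSG : ∀ x y, ⟪S x, G y⟫_ℂ = 0 := fun x y ↦ by rw [← hTr, hTG, inner_zero_right]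
  refine exists_eq_two_smul_sqrt_mul A B G (fun x y ↦ ?_) (fun x y ↦ ?_) fun x ↦ ?_
  · simp only [hBa, inner_sub_left, inner_sub_right, S.inner_map_map, hE0SG, hSGE0, h0]
    ring
  · rw [hBa, inner_sub_left, hSG, hGa, hTr, hS, sub_zero, h1]
  · rw [← Submodule.orthogonal_orthogonal_eq_closure, Submodule.mem_orthogonal]
    intro y hy
    have hBy : ∀ v, ⟪B v, y⟫_ℂ = 0 := fun v ↦
      (Submodule.mem_orthogonal _ y).1 hy _ (LinearMap.mem_range_self (B : H →ₗ[ℂ] 𝓗) v)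
    -- If `y ⊥ ran B`, then `y - S S* y` is orthogonal to every `E n`; so `y ∈ ran S`, which is
    -- orthogonal to `ran G`.
    have hz : y - S (adjoint T y) = 0 := hE _ fun n v ↦ by
      cases n with
      | zero =>
        rw [inner_sub_right, hE0SG, hTr, ← inner_sub_left, ← hBa, hBy]
      | succ n =>
        rw [← hS, inner_sub_right, S.inner_map_map, hTr, sub_self]
    rw [sub_eq_zero.1 hz, hSG]

/-! ### The tridiagonal Toeplitz kernel and its shift. -/

open MeasureTheory AddCircle in
lemma integral_fourier {T : ℝ} [hT : Fact (0 < T)] (n : ℤ) :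
    ∫ t : AddCircle T, fourier n t ∂haarAddCircle = if n = 0 then 1 else 0 := by
  split_ifs with h
  · subst h
    simp
  · exact integral_eq_zero_of_add_right_eq_neg (μ := haarAddCircle)
      (fourier_add_half_inv_index h hT.elim)

/-- The tridiagonal Toeplitz kernel with identity diagonal, `D` below and `D*` above it. -/
noncomputable def tridiagonalKernel {H : Type*} [NormedAddCommGroup H] [InnerProductSpace ℂ H] [CompleteSpace H]
    (D : H →L[ℂ] H) : Matrix ℕ ℕ (H →L[ℂ] H) :=
  .of fun m n ↦ if m = n then 1 else if m = n + 1 then D else if n = m + 1 then star D else 0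

section tridiagonalKernel

variable {H : Type*} [NormedAddCommGroup H] [InnerProductSpace ℂ H] [CompleteSpace H]
  (D : H →L[ℂ] H)

open ContinuousLinearMap in
lemma inner_tridiagonalKernel (m n : ℕ) (v w : H) :
    ⟪tridiagonalKernel D m n v, w⟫_ℂ = (if (m : ℤ) - n = 0 then 1 else 0) * ⟪v, w⟫_ℂ +
      (if (m : ℤ) - n - 1 = 0 then 1 else 0) * ⟪D v, w⟫_ℂ +
      (if (m : ℤ) - n + 1 = 0 then 1 else 0) * ⟪v, D w⟫_ℂ := by
  have e1 : (m : ℤ) - n = 0 ↔ m = n := by omega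
  have e2 : (m : ℤ) - n - 1 = 0 ↔ m = n + 1 := by omega
  have e3 : (m : ℤ) - n + 1 = 0 ↔ n = m + 1 := by omega
  simp only [tridiagonalKernel, Matrix.of_apply, e1, e2, e3]
  split_ifs <;> first | omega | simp [star_eq_adjoint, adjoint_inner_left]

lemma tridiagonalKernel_succ_succ (m n : ℕ) :
    tridiagonalKernel D (m + 1) (n + 1) = tridiagonalKernel D m n := by
  simp [tridiagonalKernel]

lemma tridiagonalKernel_isHermitian : (tridiagonalKernel D).IsHermitian := by
  ext1 m n
  simp only [Matrix.conjTranspose_apply, tridiagonalKernel, Matrix.of_apply]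
  split_ifs <;> first | omega | simp

-- The quadratic form of the kernel at `f` is the circle integral of `‖g‖² + 2 Re (e^{iθ} ⟪g, D
-- g⟫)`, where `g` is the trigonometric polynomial with coefficients `f`; the numerical range bound
-- makes the integrand nonnegative.
open MeasureTheory AddCircle in
lemma tridiagonalKernel_posSemidef (hD : ∀ x, 2 * ‖⟪x, D x⟫_ℂ‖ ≤ ‖x‖ ^ 2) :
    (tridiagonalKernel D).PosSemidef := by
  have key := (RKHS.posSemidef_tfae (K := tridiagonalKernel D)).out 0 2
  refine key.2 ⟨tridiagonalKernel_isHermitian D, fun f ↦ ?_⟩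
  have : Fact ((0 : ℝ) < 1) := ⟨zero_lt_one⟩
  let g : AddCircle (1 : ℝ) → H := fun t ↦ ∑ n ∈ f.support, fourier (n : ℤ) t • f n
  have hg : Continuous g := by fun_prop
  let I : AddCircle (1 : ℝ) → ℂ := fun t ↦ ⟪g t, g t⟫_ℂ +
    fourier (-1) t * ⟪D (g t), g t⟫_ℂ + fourier 1 t * ⟪g t, D (g t)⟫_ℂ
  have hI : Continuous I := by fun_prop
  have hI0 : ∀ t, 0 ≤ (I t).re := fun t ↦ by
    have h1 : fourier (-1) t * ⟪D (g t), g t⟫_ℂ =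
        (starRingEnd ℂ) (fourier 1 t * ⟪g t, D (g t)⟫_ℂ) := by
      rw [map_mul, inner_conj_symm, ← fourier_neg]
    have h2 : ‖fourier 1 t * ⟪g t, D (g t)⟫_ℂ‖ = ‖⟪g t, D (g t)⟫_ℂ‖ := by
      rw [norm_mul, fourier_apply, Circle.norm_coe, one_mul]
    have h3 : (⟪g t, g t⟫_ℂ).re = ‖g t‖ ^ 2 := by
      rw [inner_self_eq_norm_sq_to_K]
      norm_cast
    have h4 := neg_le_of_abs_le (Complex.abs_re_le_norm (fourier 1 t * ⟪g t, D (g t)⟫_ℂ))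
    simp only [I, h1, Complex.add_re, Complex.conj_re, h3]
    linarith [hD (g t)]
  have hIsum : ∀ t, I t = ∑ n ∈ f.support, ∑ m ∈ f.support,
      (fourier ((m : ℤ) - n) t * ⟪f n, f m⟫_ℂ + fourier ((m : ℤ) - n - 1) t * ⟪D (f n), f m⟫_ℂ +
        fourier ((m : ℤ) - n + 1) t * ⟪f n, D (f m)⟫_ℂ) := fun t ↦ by
    simp only [I, g, map_sum, map_smul, sum_inner, inner_sum, inner_smul_left, inner_smul_right,
      ← fourier_neg, Finset.mul_sum, ← Finset.sum_add_distrib]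
    rw [Finset.sum_comm]
    refine Finset.sum_congr rfl fun n _ ↦ Finset.sum_congr rfl fun m _ ↦ ?_
    simp only [sub_eq_add_neg, fourier_add]
    ring
  have hint : ∀ u : AddCircle (1 : ℝ) → ℂ, Continuous u → Integrable u haarAddCircle := fun u hu ↦
    hu.integrable_of_hasCompactSupport (HasCompactSupport.of_compactSpace u)
  have hsum : ∫ t, I t ∂haarAddCircle = f.sum fun n w ↦ f.sum fun m w' ↦
      ⟪tridiagonalKernel D m n w, w'⟫_ℂ := by
    simp only [hIsum, Finsupp.sum, inner_tridiagonalKernel]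
    rw [integral_finsetSum]
    swap
    · exact fun n _ ↦ hint _ (by fun_prop)
    refine Finset.sum_congr rfl fun n _ ↦ ?_
    rw [integral_finsetSum]
    swap
    · exact fun m _ ↦ hint _ (by fun_prop)
    refine Finset.sum_congr rfl fun m _ ↦ ?_
    rw [integral_add, integral_add]
    · simp only [integral_mul_const, integral_fourier]
    all_goals exact hint _ (by fun_prop)
  rw [← hsum, ← integral_re (hint I hI)]
  exact integral_nonneg hI0

open RKHS in
/-- The isometric shift on the Hilbert space generated by the tridiagonal kernel. -/
lemma exists_shift (hK : (tridiagonalKernel D).PosSemidef) :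
    haveI := Fact.mk hK
    ∃ S : OfKernel (tridiagonalKernel D) →ₗᵢ[ℂ] OfKernel (tridiagonalKernel D),
      ∀ n v, S (kerFun (OfKernel (tridiagonalKernel D)) n v) = kerFun _ (n + 1) v := by
  have := Fact.mk hK
  let E : ℕ → H →L[ℂ] OfKernel (tridiagonalKernel D) := kerFun _
  have hE : ∀ m n v w, ⟪E n v, E m w⟫_ℂ = ⟪tridiagonalKernel D m n v, w⟫_ℂ := fun m n v w ↦ by
    rw [← kernel_inner, OfKernel.kernel_ofKernel]
  let Φ : ℕ → (ℕ →₀ H) →ₗ[ℂ] OfKernel (tridiagonalKernel D) := fun k ↦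
    Finsupp.lsum ℂ fun n ↦ (E (n + k) : H →ₗ[ℂ] _)
  have hΦ : ∀ k n v, Φ k (Finsupp.single n v) = E (n + k) v := fun k n v ↦ by simp [Φ]
  -- The Toeplitz property makes the shift isometric.
  have hnorm : ∀ f, ‖Φ 1 f‖ = ‖Φ 0 f‖ := fun f ↦ by
    rw [@norm_eq_sqrt_re_inner ℂ, @norm_eq_sqrt_re_inner ℂ _ _ _ _ (Φ 0 f)]
    congr 2
    simp only [Φ, Finsupp.lsum_apply, Finsupp.sum, sum_inner, inner_sum,
      ContinuousLinearMap.coe_coe, hE, tridiagonalKernel_succ_succ, add_zero]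
  have hdense : DenseRange (Φ 0) := by
    have h := kerFun_dense (𝕜 := ℂ) (OfKernel (tridiagonalKernel D))
    rw [← Submodule.dense_iff_topologicalClosure_eq_top] at h
    refine h.mono ?_
    have : Submodule.span ℂ {x | ∃ n v, kerFun (OfKernel (tridiagonalKernel D)) n v = x} ≤
        LinearMap.range (Φ 0) := by
      rw [Submodule.span_le]
      rintro _ ⟨n, v, rfl⟩
      exact ⟨Finsupp.single n v, hΦ 0 n v⟩
    exact this
  obtain ⟨S, hS⟩ := exists_linearIsometry_of_norm_eq (Φ 0) (Φ 1) hdense hnorm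
  refine ⟨S, fun n v ↦ ?_⟩
  have := hS (Finsupp.single n v)
  rwa [hΦ, hΦ] at this

end tridiagonalKernel

/-! ### Numerical radius and block operators. -/

section numericalRadius

variable {H : Type*} [NormedAddCommGroup H] [InnerProductSpace ℂ H]

lemma numericalRadius_le_one_iff (A : H →L[ℂ] H) :
    numericalRadius A ≤ 1 ↔ ∀ x, ‖⟪x, A x⟫_ℂ‖ ≤ ‖x‖ ^ 2 := by
  constructor
  · intro h x
    rcases eq_or_ne x 0 with rfl | hx
    · simp
    have hx' : 0 < ‖x‖ := norm_pos_iff.2 hx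
    have hbdd : BddAbove {r : ℝ | ∃ x : H, ‖x‖ = 1 ∧ r = ‖⟪x, A x⟫_ℂ‖} := by
      refine ⟨‖A‖, ?_⟩
      rintro _ ⟨y, hy, rfl⟩
      calc ‖⟪y, A y⟫_ℂ‖ ≤ ‖y‖ * ‖A y‖ := norm_inner_le_norm _ _
        _ ≤ ‖A‖ := by simpa [hy] using A.le_opNorm y
    have h1 := (le_csSup hbdd ⟨((‖x‖⁻¹ : ℝ) : ℂ) • x, by
      rw [norm_smul, Complex.norm_real, norm_inv, norm_norm, inv_mul_cancel₀ hx'.ne'], rfl⟩).trans h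
    rw [map_smul, inner_smul_left, inner_smul_right, Complex.conj_ofReal, norm_mul, norm_mul,
      Complex.norm_real, norm_inv, norm_norm, ← mul_assoc, ← mul_inv, ← sq,
      inv_mul_le_iff₀ (by positivity), mul_one] at h1
    exact h1
  · intro h
    refine Real.sSup_le ?_ zero_le_one
    rintro _ ⟨y, hy, rfl⟩
    simpa [hy] using h y

lemma blockOperator_inner (P Q R S : H →L[ℂ] H) (x y : WithLp 2 (H × H)) :
    ⟪blockOperator P Q R S x, y⟫_ℂ =
      ⟪P x.fst + Q x.snd, y.fst⟫_ℂ + ⟪R x.fst + S x.snd, y.snd⟫_ℂ := by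
  rw [WithLp.prod_inner_apply]
  rfl

variable [CompleteSpace H]

open RKHS in
lemma exists_eq_two_smul_sqrt_mul_of_numericalRadius_le_one (A : H →L[ℂ] H)
    (hA : numericalRadius A ≤ 1) :
    ∃ C : H →L[ℂ] H, ‖C‖ ≤ 1 ∧ A = (2 : ℂ) • (CFC.sqrt (1 - star C * C) * C) := by
  rw [numericalRadius_le_one_iff] at hA
  set D : H →L[ℂ] H := (2⁻¹ : ℂ) • A with hD
  have hK : (tridiagonalKernel D).PosSemidef := tridiagonalKernel_posSemidef D fun x ↦ by
    simpa [hD, inner_smul_right] using hA x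
  have := Fact.mk hK
  obtain ⟨S, hS⟩ := exists_shift D hK
  have hE : ∀ m n v w, ⟪kerFun (OfKernel (tridiagonalKernel D)) n v, kerFun _ m w⟫_ℂ =
      ⟪tridiagonalKernel D m n v, w⟫_ℂ := fun m n v w ↦ by
    rw [← kernel_inner, OfKernel.kernel_ofKernel]
  refine exists_eq_two_smul_sqrt_mul_of_shift A (kerFun (OfKernel (tridiagonalKernel D))) S hS
    (fun y hy ↦ ?_) (fun v w ↦ ?_) (fun v w ↦ ?_) fun n v w ↦ ?_
  · ext n
    refine ext_inner_left ℂ fun v ↦ ?_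
    rw [← kerFun_inner, hy, coe_zero, Pi.zero_apply, inner_zero_right]
  · rw [hE, inner_tridiagonalKernel]
    simp
  · rw [hE, inner_tridiagonalKernel]
    simp [hD]
  · rw [hE, inner_tridiagonalKernel]
    have e1 : ((0 : ℕ) : ℤ) - (n + 2 : ℕ) ≠ 0 := by omega
    have e2 : ((0 : ℕ) : ℤ) - (n + 2 : ℕ) - 1 ≠ 0 := by omega
    have e3 : ((0 : ℕ) : ℤ) - (n + 2 : ℕ) + 1 ≠ 0 := by omega
    simp only [if_neg e1, if_neg e2, if_neg e3, zero_mul, add_zero]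

lemma one_sub_star_mul_self_nonneg {C : H →L[ℂ] H} (hC : ‖C‖ ≤ 1) : 0 ≤ 1 - star C * C := by
  rw [sub_nonneg, ← CStarAlgebra.norm_le_one_iff_of_nonneg _ (star_mul_self_nonneg C),
    CStarRing.norm_star_mul_self]
  exact mul_le_one₀ hC (norm_nonneg _) hC

-- With this choice of Hermitian part the block operator is `2 Z* Z` for the row `Z = [Y X]`.
open ContinuousLinearMap in
lemma blockOperator_isPositive_of_factorization {A X Y : H →L[ℂ] H}
    (h : star X * X + star Y * Y = 1) (hA : A = (2 : ℂ) • (star X * Y)) :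
    (blockOperator (1 + (star Y * Y - star X * X)) (star A) A
      (1 - (star Y * Y - star X * X))).IsPositive := by
  have h1 : 1 + (star Y * Y - star X * X) = (2 : ℂ) • (star Y * Y) := by
    rw [← h, two_smul]; abel
  have h2 : 1 - (star Y * Y - star X * X) = (2 : ℂ) • (star X * X) := by
    rw [← h, two_smul]; abel
  have h3 : star A = (2 : ℂ) • (star Y * X) := by
    rw [hA, star_smul, star_mul, star_star]
    simp
  have key : ∀ x y : WithLp 2 (H × H), ⟪blockOperator (1 + (star Y * Y - star X * X)) (star A) A
      (1 - (star Y * Y - star X * X)) x, y⟫_ℂ =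
      2 * ⟪Y x.fst + X x.snd, Y y.fst + X y.snd⟫_ℂ := fun x y ↦ by
    rw [blockOperator_inner, h1, h2, h3, hA]
    simp only [smul_apply, FunLike.coe_mul_eq_comp, Function.comp_apply, star_eq_adjoint,
      inner_add_left, inner_add_right, inner_smul_left, adjoint_inner_left, map_ofNat]
    ring
  rw [isPositive_iff_complex]
  intro x
  have hx : 2 * ⟪Y x.fst + X x.snd, Y x.fst + X x.snd⟫_ℂ =
      ((2 * ‖Y x.fst + X x.snd‖ ^ 2 : ℝ) : ℂ) := by
    rw [inner_self_eq_norm_sq_to_K]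
    push_cast
    rfl
  rw [key, hx, RCLike.re_to_complex, Complex.ofReal_re]
  exact ⟨rfl, by positivity⟩

open ContinuousLinearMap in
lemma numericalRadius_le_one_of_blockOperator_isPositive {A K : H →L[ℂ] H}
    (h : (blockOperator (1 + K) (star A) A (1 - K)).IsPositive) : numericalRadius A ≤ 1 := by
  rw [numericalRadius_le_one_iff]
  intro x
  obtain ⟨c, hc, hcx⟩ : ∃ c : ℂ, ‖c‖ = 1 ∧ c * ⟪x, A x⟫_ℂ = -‖⟪x, A x⟫_ℂ‖ := by
    rcases eq_or_ne ⟪x, A x⟫_ℂ 0 with h0 | h0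
    · exact ⟨1, by simp, by simp [h0]⟩
    · refine ⟨-‖⟪x, A x⟫_ℂ‖ / ⟪x, A x⟫_ℂ, ?_, div_mul_cancel₀ _ h0⟩
      rw [norm_div, norm_neg, Complex.norm_real, norm_norm, div_self (norm_ne_zero_iff.2 h0)]
  have hc' : c * (starRingEnd ℂ) c = 1 := by
    rw [Complex.mul_conj, Complex.normSq_eq_norm_sq, hc]
    simp
  have hcx' : (starRingEnd ℂ) c * ⟪A x, x⟫_ℂ = -‖⟪x, A x⟫_ℂ‖ := by
    rw [← inner_conj_symm, ← map_mul, hcx]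
    simp
  -- On the vector `(c x, x)` the two `K` terms cancel because `|c| = 1`, and the phase of `c` makes
  -- both off-diagonal terms equal to `-|⟪x, A x⟫|`.
  have h1 := h.re_inner_nonneg_left (WithLp.toLp 2 (c • x, x) : WithLp 2 (H × H))
  rw [blockOperator_inner] at h1
  have h2 : ⟪(1 + K) (c • x) + star A x, c • x⟫_ℂ + ⟪A (c • x) + (1 - K) x, x⟫_ℂ =
      ((2 * ‖x‖ ^ 2 - 2 * ‖⟪x, A x⟫_ℂ‖ : ℝ) : ℂ) := by
    have h3 : ⟪x, x⟫_ℂ = ((‖x‖ ^ 2 : ℝ) : ℂ) := by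
      rw [inner_self_eq_norm_sq_to_K]
      norm_cast
    simp only [map_smul, add_apply, sub_apply, one_apply_eq_self, inner_add_left, inner_sub_left,
      inner_smul_left, inner_smul_right, star_eq_adjoint, adjoint_inner_left, h3]
    push_cast
    linear_combination (((‖x‖ : ℂ) ^ 2) + ⟪K x, x⟫_ℂ) * hc' + hcx + hcx'
  change 0 ≤ RCLike.re (⟪(1 + K) (c • x) + star A x, c • x⟫_ℂ +
    ⟪A (c • x) + (1 - K) x, x⟫_ℂ) at h1
  rw [h2, RCLike.re_to_complex, Complex.ofReal_re] at h1
  linarith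

end numericalRadius

theorem theorem3 {H : Type*} [NormedAddCommGroup H] [InnerProductSpace ℂ H] [CompleteSpace H]
    (A : H →L[ℂ] H) :
    List.TFAE [
      numericalRadius A ≤ 1,
      ∃ X Y : H →L[ℂ] H, star X * X + star Y * Y = 1 ∧ A = (2 : ℂ) • (star X * Y),
      ∃ C : H →L[ℂ] H, ‖C‖ ≤ 1 ∧ A = (2 : ℂ) • (CFC.sqrt (1 - star C * C) * C),
      ∃ K : H →L[ℂ] H, IsSelfAdjoint K ∧
        (blockOperator (1 + K) (star A) A (1 - K)).IsPositive] := by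
  tfae_have 1 → 3 := exists_eq_two_smul_sqrt_mul_of_numericalRadius_le_one A
  tfae_have 3 → 2 := by
    rintro ⟨C, hC, hA⟩
    have hs : star (CFC.sqrt (1 - star C * C)) = CFC.sqrt (1 - star C * C) :=
      (IsSelfAdjoint.of_nonneg (CFC.sqrt_nonneg _)).star_eq
    refine ⟨CFC.sqrt (1 - star C * C), C, ?_, by rwa [hs]⟩
    rw [hs, CFC.sqrt_mul_sqrt_self _ (one_sub_star_mul_self_nonneg hC), sub_add_cancel]
  tfae_have 2 → 4 := by
    rintro ⟨X, Y, h, hA⟩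
    exact ⟨star Y * Y - star X * X, (IsSelfAdjoint.star_mul_self Y).sub (.star_mul_self X),
      blockOperator_isPositive_of_factorization h hA⟩
  tfae_have 4 → 1 := by
    rintro ⟨K, -, hK⟩
    exact numericalRadius_le_one_of_blockOperator_isPositive hK
  tfae_finish
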